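/- Let $\Lambda_D(a,x)\in\mathbb Z[a^{\pm1},x^{\pm1}]$ be the Kauffman polynomial of regular isotopy of (nonempty) unoriented link diagrams: the unique regular isotopy invariant with $\Lambda_{\bigcirc}=1$ for the circle without crossings, with $\Lambda_D=a^{\varepsilon}\Lambda_{D'}$ if $D'$ is obtained from $D$ by removing a kink whose crossing has sign $\varepsilon=\pm1$, and with $\Lambda_{L_+}+\Lambda_{L_-}=x(\Lambda_{L_0}+\Lambda_{L_\infty})$. For an oriented diagram $D$ with writhe $w(D)$ let $F_D(a,x)=a^{-w(D)}\Lambda_D(a,x)$. A 5-move replaces two parallel strands of a diagram by five right-handed half-twists. Two unoriented, unframed links are 5-move equivalent if their diagrams are related by a finite sequence of planar isotopies, Reidemeister moves, 5-moves and inverses of these. Put $$v_1^{(5)}(x)=T_4(x),\qquad v_2^{(5)}(a,x)=\sum_{i=1}^{4}T_{i-1}(x)\,a^{i-5},$$ where $T_0=1$, $T_1=x$ and $T_{n+2}=xT_{n+1}-T_n$. **Corollary 3.8.** Let $L_1$, $L_2$ be 5-move equivalent links, given by diagrams. Then the following holds. (i) Let $I$ be the ideal of $\mathbb Z[a^{\pm1},x^{\pm1}]$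 generated by $v_1^{(5)}(x)$ and $v_2^{(5)}(a,x)$. There is $i\in\mathbb Z$ with $\Lambda_{L_1}\equiv a^i\Lambda_{L_2} \bmod I$, and for all orientations of $L_1$ and $L_2$ there is $i\in\mathbb Z$ with $F_{L_1}\equiv a^iF_{L_2}\bmod I$. (ii) Let $a_0,p_0\in\mathbb C$ satisfy $a_0^{10}=1$, $p_0^5=a_0^5$, $a_0\ne p_0,p_0^{-1}$ and $p_0\neq 1,-1,i,-i$ (here $i$ is the imaginary unit), and let $x_0=p_0+p_0^{-1}$. Then for all orientations of $L_1$ and $L_2$ $$\{a_0^jF_{L_1}(a_0,x_0): j\in\mathbb Z\}=\{a_0^jF_{L_2}(a_0,x_0): j\in\mathbb Z\}\quad\text{and}\quad |F_{L_1}(a_0,x_0)|=|F_{L_2}(a_0,x_0)|.$$ (iii) For all orientations of $L_1$ and $L_2$ there is $i\in\mathbb Z$ with $$F_{L_1}(a,a+a^{-1})\equiv a^iF_{L_2}(a,a+a^{-1}) \bmod (5,(a^2-1)^3).$$ Here the substitution $x=a+a^{-1}$ is made in $\mathbb Z[a^{\pm1},(a+a^{-1})^{-1}]$ and the congruence holds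 modulo the ideal generated there; whenever both values lie in $\mathbb Z[a^{\pm1}]$, it holds, with the same $i$, modulo the ideal $(5,(a^2-1)^3)$ of $\mathbb Z[a^{\pm1}]$. -/

import Mathlib

open scoped LaurentPolynomial

noncomputable section

namespace FiveMove

/-! ### Unoriented link diagrams

A link diagram in the plane, put in general position with respect to the height function, is cut by
horizontal lines into slices with a single minimum, maximum or crossing each.  It is recorded as
the list of its slices, read from bottom to top. -/

/-- The four kinds of slices: a local minimum, a local maximum, and the two crossings.
`twistR` is the right-handed half-twist of two vertical strands (the strand running from bottom left
to top right is the overcrossing one), `twistL` is the left-handed one. -/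
inductive Kind
  | cup
  | cap
  | twistR
  | twistL

/-- Number of strands entering the nontrivial part of a slice from below. -/
def Kind.inp : Kind → ℕ
  | .cup => 0
  | .cap => 2
  | .twistR => 2
  | .twistL => 2

/-- Number of strands leaving the nontrivial part of a slice at its top. -/
def Kind.out : Kind → ℕ
  | .cup => 2
  | .cap => 0
  | .twistR => 2
  | .twistL => 2

/-- A slice: its kind and the number of vertical strands to the left of its nontrivial part. -/
structure Slice where
  kind : Kind
  pos : ℕ

/-- A local minimum with `i` strands to its left. -/
abbrev cup (i : ℕ) : Slice := ⟨.cup, i⟩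
/-- A local maximum with `i` strands to its left. -/
abbrev cap (i : ℕ) : Slice := ⟨.cap, i⟩
/-- A right-handed half-twist with `i` strands to its left. -/
abbrev twistR (i : ℕ) : Slice := ⟨.twistR, i⟩
/-- A left-handed half-twist with `i` strands to its left. -/
abbrev twistL (i : ℕ) : Slice := ⟨.twistL, i⟩

/-- `IsTangle n w m`: the slices `w` can be stacked on top of `n` strands, and `m` strands come out
at the top. -/
def IsTangle : ℕ → List Slice → ℕ → Prop
  | n, [], m => n = m
  | n, e :: w, m => e.pos + e.kind.inp ≤ n ∧ IsTangle (n - e.kind.inp + e.kind.out) w m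

/-- Diagrams of (nonempty) unoriented links. -/
def LinkDiagram : Type := {w : List Slice // IsTangle 0 w 0 ∧ w ≠ []}

/-- The slices of a diagram. -/
def LinkDiagram.slices (D : LinkDiagram) : List Slice := D.1

/-- The round circle. -/
def unknot : LinkDiagram := ⟨[cup 0, cap 0], by simp [IsTangle, Kind.inp, Kind.out]⟩

/-! ### Local moves -/

/-- Planar isotopies of diagrams and the second and third Reidemeister moves. -/
inductive RegularMove : List Slice → List Slice → Prop
  /-- Nontrivial parts of two slices which have `d` strands between them pass each other. -/
  | exchange (g h : Kind) (i d : ℕ) :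
      RegularMove [⟨g, i⟩, ⟨h, i + g.out + d⟩] [⟨h, i + g.inp + d⟩, ⟨g, i⟩]
  | zigzagLeft (i : ℕ) : RegularMove [cup i, cap (i + 1)] []
  | zigzagRight (i : ℕ) : RegularMove [cup (i + 1), cap i] []
  /-- A strand crossing one side of a minimum or maximum is moved to its other side. -/
  | slideCupR (i : ℕ) : RegularMove [cup i, twistR (i + 1)] [cup (i + 1), twistL i]
  | slideCupL (i : ℕ) : RegularMove [cup i, twistL (i + 1)] [cup (i + 1), twistR i]
  | slideCapR (i : ℕ) : RegularMove [twistR (i + 1), cap i] [twistL i, cap (i + 1)]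
  | slideCapL (i : ℕ) : RegularMove [twistL (i + 1), cap i] [twistR i, cap (i + 1)]
  | reidemeisterTwoRL (i : ℕ) : RegularMove [twistR i, twistL i] []
  | reidemeisterTwoLR (i : ℕ) : RegularMove [twistL i, twistR i] []
  | reidemeisterThree (i : ℕ) :
      RegularMove [twistR i, twistR (i + 1), twistR i] [twistR (i + 1), twistR i, twistR (i + 1)]

/-- The first Reidemeister move: `Kink r s ε` says that `s` is obtained from `r` by removing a kink
whose crossing has sign `ε`.  (The strands of a kink at a minimum or maximum are antiparallel, so
a right-handed half-twist there is a negative crossing.) -/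
inductive Kink : List Slice → List Slice → ℤ → Prop
  | cupR (i : ℕ) : Kink [cup i, twistR i] [cup i] (-1)
  | cupL (i : ℕ) : Kink [cup i, twistL i] [cup i] 1
  | capR (i : ℕ) : Kink [twistR i, cap i] [cap i] (-1)
  | capL (i : ℕ) : Kink [twistL i, cap i] [cap i] 1

/-- The `k`-move: two parallel strands are replaced by `k` right-handed half-twists. -/
inductive TwistMove (k : ℕ) : List Slice → List Slice → Prop
  | twist (i : ℕ) : TwistMove k [] (List.replicate k (twistR i))

/-- `D'` is obtained from `D` by applying the move `M` to a part of the diagram. -/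
def Local (M : List Slice → List Slice → Prop) (D D' : LinkDiagram) : Prop :=
  ∃ u r s v, M r s ∧ D.slices = u ++ r ++ v ∧ D'.slices = u ++ s ++ v

/-- `k`-move equivalence of unoriented (unframed) links: the equivalence relation on diagrams that is
generated by isotopy (planar isotopy and the three Reidemeister moves) and `k`-moves. -/
def MoveEquivalent (k : ℕ) : LinkDiagram → LinkDiagram → Prop :=
  Relation.EqvGen fun D D' =>
    Local RegularMove D D' ∨ Local (fun r s => ∃ ε, Kink r s ε) D D' ∨ Local (TwistMove k) D D'

/-! ### Orientations and writhe -/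

/-- `Orientation s w t`: an orientation of the tangle `w`, whose strands are directed at the bottom
and at the top as prescribed by `s` and `t` (`true` for upwards, `false` for downwards). -/
inductive Orientation : List Bool → List Slice → List Bool → Type
  | nil (s : List Bool) : Orientation s [] s
  | cup (l r : List Bool) (b : Bool) {w : List Slice} {t : List Bool} :
      Orientation (l ++ b :: (!b) :: r) w t → Orientation (l ++ r) (cup l.length :: w) t
  | cap (l r : List Bool) (b : Bool) {w : List Slice} {t : List Bool} :
      Orientation (l ++ r) w t → Orientation (l ++ b :: (!b) :: r) (cap l.length :: w) t
  | twistR (l r : List Bool) (b c : Bool) {w : List Slice} {t : List Bool} :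
      Orientation (l ++ c :: b :: r) w t → Orientation (l ++ b :: c :: r) (twistR l.length :: w) t
  | twistL (l r : List Bool) (b c : Bool) {w : List Slice} {t : List Bool} :
      Orientation (l ++ c :: b :: r) w t → Orientation (l ++ b :: c :: r) (twistL l.length :: w) t

/-- The writhe: the sum of the signs of all crossings.  A right-handed half-twist is positive if its
two strands are parallel, and negative if they are antiparallel. -/
def Orientation.writhe {s t : List Bool} {w : List Slice} : Orientation s w t → ℤ
  | .nil _ => 0
  | .cup _ _ _ o => o.writhe
  | .cap _ _ _ o => o.writhe
  | .twistR _ _ b c o => (if b = c then 1 else -1) + o.writhe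
  | .twistL _ _ b c o => (if b = c then -1 else 1) + o.writhe

/-- An orientation of a link diagram. -/
abbrev LinkDiagram.Orientation (D : LinkDiagram) : Type := FiveMove.Orientation [] D.slices []

/-! ### The Kauffman polynomial -/

/-- The ring `ℤ[a^{±1}, x^{±1}]`, as Laurent polynomials in `x` over Laurent polynomials in `a`. -/
abbrev KRing : Type := ℤ[T;T⁻¹][T;T⁻¹]

/-- The monomial `a ^ i`. -/
def aPow (i : ℤ) : KRing := LaurentPolynomial.C (LaurentPolynomial.T i)

/-- The variable `x`. -/
def xVar : KRing := LaurentPolynomial.T 1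

/-- The defining properties of the Kauffman polynomial of regular isotopy. -/
structure IsKauffman (Λ : LinkDiagram → KRing) : Prop where
  regular : ∀ D D' : LinkDiagram, Local RegularMove D D' → Λ D = Λ D'
  initial : Λ unknot = 1
  framing : ∀ (ε : ℤ) (D D' : LinkDiagram), Local (fun r s => Kink r s ε) D D' →
    Λ D = aPow ε * Λ D'
  skein : ∀ (u v : List Slice) (i : ℕ) (Dp Dm D0 Dinf : LinkDiagram),
    Dp.slices = u ++ [twistR i] ++ v → Dm.slices = u ++ [twistL i] ++ v →
    D0.slices = u ++ v → Dinf.slices = u ++ [cap i, cup i] ++ v →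
    Λ Dp + Λ Dm = xVar * (Λ D0 + Λ Dinf)

open Classical in
/-- The Kauffman polynomial `Λ_D(a, x)` of regular isotopy: the unique function on diagrams with the
properties `IsKauffman`.  That there is exactly one such function is Kauffman's theorem; a value for
the other case has to be given only because this theorem is not part of the library. -/
def Lam : LinkDiagram → KRing :=
  if h : ∃! Λ : LinkDiagram → KRing, IsKauffman Λ then h.choose else 0

/-- The Kauffman polynomial `F(a, x) = a ^ (-w) Λ(a, x)` of an oriented diagram. -/
def F {D : LinkDiagram} (o : D.Orientation) : KRing := aPow (-o.writhe) * Lam D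

/-! ### The ideal generated by `v₁` and `v₂` -/

/-- The shifted Chebyshev polynomial `T_n(x)`, with `T_0 = 1`, `T_1 = x`,
`T_{n+2} = x T_{n+1} - T_n`. -/
def cheb (n : ℤ) : KRing := Polynomial.aeval xVar (Polynomial.Chebyshev.S ℤ n)

/-- `v₁^{(k)}(x) = T_{k-1}(x)`, which is `(p^k - p^{-k}) / (p - p^{-1})` for `x = p + p^{-1}`. -/
def v1 (k : ℕ) : KRing := cheb ((k : ℤ) - 1)

/-- `v₂^{(k)}(a, x) = ∑_{i=1}^{k-1} T_{i-1}(x) a^{i-k}`. -/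
def v2 (k : ℕ) : KRing :=
  ∑ i ∈ Finset.Icc 1 (k - 1), cheb ((i : ℤ) - 1) * aPow ((i : ℤ) - (k : ℤ))

/-- The ideal of `ℤ[a^{±1}, x^{±1}]` generated by `v₁^{(k)}` and `v₂^{(k)}`. -/
def vIdeal (k : ℕ) : Ideal KRing := Ideal.span {v1 k, v2 k}

/-! ### Substitutions -/

/-- The value `P(a₀, x₀)` at nonzero complex numbers. -/
def evalC (a₀ x₀ : ℂ) (ha : a₀ ≠ 0) (hx : x₀ ≠ 0) : KRing →+* ℂ :=
  LaurentPolynomial.eval₂ (LaurentPolynomial.eval₂ (Int.castRingHom ℂ) (Units.mk0 a₀ ha))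
    (Units.mk0 x₀ hx)

theorem ne_zero_of_pow_ten {a₀ : ℂ} (h : a₀ ^ 10 = 1) : a₀ ≠ 0 := by
  rintro rfl; norm_num at h

theorem add_inv_ne_zero {a₀ p₀ : ℂ} (h : a₀ ^ 10 = 1) (hp : p₀ ^ 5 = a₀ ^ 5)
    (h1 : p₀ ≠ Complex.I) (h2 : p₀ ≠ -Complex.I) : p₀ + p₀⁻¹ ≠ 0 := by
  have h0 : p₀ ≠ 0 := by
    rintro rfl
    have : a₀ ^ 5 = 0 := by simpa using hp.symm
    exact ne_zero_of_pow_ten h (by simpa using this)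
  intro hs
  have hm : (p₀ - Complex.I) * (p₀ + Complex.I) = 0 := by
    field_simp at hs
    linear_combination hs - Complex.I_sq
  rcases mul_eq_zero.1 hm with h' | h'
  · exact h1 (sub_eq_zero.1 h')
  · exact h2 (eq_neg_of_add_eq_zero_left h')

/-- The ring `ℤ[a^{±1}, (a + a^{-1})^{-1}]`, in which `x^{±1}` can be replaced by
`(a + a^{-1})^{±1}`. -/
abbrev ARing : Type :=
  Localization.Away (LaurentPolynomial.T 1 + LaurentPolynomial.T (-1) : ℤ[T;T⁻¹])

/-- The substitution `P(a, x) ↦ P(a, a + a^{-1})`. -/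
def substX : KRing →+* ARing :=
  LaurentPolynomial.eval₂ (algebraMap ℤ[T;T⁻¹] ARing)
    (IsLocalization.Away.algebraMap_isUnit (S := ARing)
      (LaurentPolynomial.T 1 + LaurentPolynomial.T (-1) : ℤ[T;T⁻¹])).unit

/-- The ideal `(5, (a^2 - 1)^3)` of `ℤ[a^{±1}]`. -/
def fiveIdeal : Ideal ℤ[T;T⁻¹] := Ideal.span {5, (LaurentPolynomial.T 2 - 1) ^ 3}

end FiveMove

end

open FiveMove

/-!
Stacking `n` right-handed half-twists at a fixed place of a diagram gives diagrams `A_n`; closing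
them by a maximum and placing a minimum on it gives a diagram that loses its `n` kinks at the price
of `a⁻ⁿ`. With `E` the diagram without kinks, the skein relation at the top crossing therefore reads
`Λ(A_{n+2}) + Λ(A_n) = x (Λ(A_{n+1}) + a⁻ⁿ⁻¹ Λ(E))`. Solving this recursion with Chebyshev
polynomials exhibits `Λ(A_k) - a⁻ᵏ Λ(A_0)` as a combination of `v₁` and `v₂`, which gives (i).

For (ii) and (iii) it remains to see that `v₁` and `v₂` vanish after the substitution. If
`x = p + p⁻¹`, then `(p - p⁻¹) v₁ = pᵏ - p⁻ᵏ`, and `(a + a⁻¹ - x) v₂` telescopes to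
`a⁻ᵏ + T_{k-2} - a⁻¹ T_{k-1}`. If `x = a + a⁻¹` and `k` is prime, the second identity is void; there
`aᵏ v₂ = a ∑_{i<k} ∑_{j<i} a²ʲ`, and modulo `k` the double sum is `(a² - 1)ᵏ⁻²`.
-/

namespace FiveMove

/-! ### Rows of half-twists inside a diagram -/

theorem isTangle_append {u v : List Slice} {n m : ℕ} :
    IsTangle n (u ++ v) m ↔ ∃ k, IsTangle n u k ∧ IsTangle k v m := by
  induction u generalizing n with
  | nil => simp [IsTangle]
  | cons e u ih => simp [IsTangle, ih, and_assoc]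

theorem IsTangle.append {u v : List Slice} {n k m : ℕ} (hu : IsTangle n u k)
    (hv : IsTangle k v m) : IsTangle n (u ++ v) m :=
  isTangle_append.2 ⟨k, hu, hv⟩

theorem IsTangle.unique {w : List Slice} {n m m' : ℕ} (h : IsTangle n w m)
    (h' : IsTangle n w m') : m = m' := by
  induction w generalizing n with
  | nil => exact h.symm.trans h'
  | cons e w ih => exact ih h.2 h'.2

theorem isTangle_replicate_twistR {i k : ℕ} (h : i + 2 ≤ k) (n : ℕ) :
    IsTangle k (List.replicate n (twistR i)) k := by
  induction n with
  | zero => rfl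
  | succ n ih =>
    rw [List.replicate_succ]
    refine ⟨h, ?_⟩
    rwa [show k - Kind.twistR.inp + Kind.twistR.out = k by simp only [Kind.inp, Kind.out]; omega]

theorem isTangle_twistL {i k : ℕ} (h : i + 2 ≤ k) : IsTangle k [twistL i] k :=
  ⟨h, by simp only [IsTangle, Kind.inp, Kind.out]; omega⟩

theorem isTangle_cap_cup {i k : ℕ} (h : i + 2 ≤ k) : IsTangle k [cap i, cup i] k :=
  ⟨h, by simp only [IsTangle, Kind.inp, Kind.out]; omega⟩

/-- A place where half-twists can be inserted into a link diagram: the diagram is cut along a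
horizontal line meeting `width` strands, and two neighbouring strands with `pos` strands to their
left are singled out. -/
structure TwistSite where
  below : List Slice
  above : List Slice
  width : ℕ
  pos : ℕ
  isTangle_below : IsTangle 0 below width
  isTangle_above : IsTangle width above 0
  pos_add_two_le : pos + 2 ≤ width

namespace TwistSite

variable (s : TwistSite)

theorem below_ne_nil : s.below ≠ [] := fun h => by
  have hw : 0 = s.width := by simpa only [h, IsTangle] using s.isTangle_below
  have := s.pos_add_two_le
  omega

/-- The diagram in which the tangle `w` is inserted at the site `s`. -/
def fill (w : List Slice) (hw : IsTangle s.width w s.width) : LinkDiagram :=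
  ⟨s.below ++ w ++ s.above, (s.isTangle_below.append hw).append s.isTangle_above, by
    simp [s.below_ne_nil]⟩

@[simp]
theorem slices_fill (w : List Slice) (hw : IsTangle s.width w s.width) :
    (s.fill w hw).slices = s.below ++ w ++ s.above :=
  rfl

/-- The row of `n` half-twists on its own, the diagram `A_n` of the recursion. -/
def twists (n : ℕ) : LinkDiagram :=
  s.fill (List.replicate n (twistR s.pos)) (isTangle_replicate_twistR s.pos_add_two_le n)

/-- The row of `n` half-twists followed by a left-handed half-twist, which undoes one of them. -/
def twistsTwistL (n : ℕ) : LinkDiagram :=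
  s.fill (List.replicate n (twistR s.pos) ++ [twistL s.pos])
    ((isTangle_replicate_twistR s.pos_add_two_le n).append (isTangle_twistL s.pos_add_two_le))

/-- The row of `n` half-twists closed by a maximum, on which a minimum is placed: the smoothing
`L_∞` of a crossing on top of the row. -/
def twistsCapCup (n : ℕ) : LinkDiagram :=
  s.fill (List.replicate n (twistR s.pos) ++ [cap s.pos, cup s.pos])
    ((isTangle_replicate_twistR s.pos_add_two_le n).append (isTangle_cap_cup s.pos_add_two_le))

end TwistSite

theorem exists_twistSite_of_local_twistMove {k : ℕ} (hk : k ≠ 0) {D D' : LinkDiagram}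
    (h : Local (TwistMove k) D D') : ∃ s : TwistSite, D = s.twists 0 ∧ D' = s.twists k := by
  obtain ⟨u, _, _, v, ⟨i⟩, hD, hD'⟩ := h
  have hu' : IsTangle 0 (u ++ List.replicate k (twistR i) ++ v) 0 := hD' ▸ D'.2.1
  obtain ⟨m, hur, hv⟩ := isTangle_append.1 hu'
  obtain ⟨l, hu, hr⟩ := isTangle_append.1 hur
  have hil : i + 2 ≤ l := by
    obtain ⟨n, rfl⟩ := Nat.exists_eq_add_one_of_ne_zero hk
    exact hr.1
  obtain rfl := hr.unique (isTangle_replicate_twistR hil k)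
  exact ⟨⟨u, v, m, i, hu, hv, hil⟩, Subtype.ext hD, Subtype.ext hD'⟩

/-! ### The polynomials `v₁` and `v₂` -/

theorem aPow_add (i j : ℤ) : aPow (i + j) = aPow i * aPow j := by
  simp only [aPow, LaurentPolynomial.T_add, map_mul]

theorem aPow_zero : aPow 0 = 1 := by
  simp only [aPow, LaurentPolynomial.T_zero, map_one]

theorem aPow_mul_aPow_neg (i : ℤ) : aPow i * aPow (-i) = 1 := by
  rw [← aPow_add, add_neg_cancel, aPow_zero]

theorem aPow_neg_natCast_succ (n : ℕ) : aPow (-(n + 1 : ℕ)) = aPow (-1) * aPow (-n) := by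
  rw [← aPow_add, Nat.cast_succ, neg_add_rev]

theorem v1_zero : v1 0 = 0 := by simp [v1, cheb]

theorem v1_one : v1 1 = 1 := by simp [v1, cheb]

theorem v1_add_two (n : ℕ) : v1 (n + 2) = xVar * v1 (n + 1) - v1 n := by
  have h := congrArg (Polynomial.aeval xVar) (Polynomial.Chebyshev.S_add_one ℤ n)
  simpa [v1, cheb, add_sub_assoc] using h

theorem v2_zero : v2 0 = 0 := by simp [v2]

theorem v2_succ (n : ℕ) : v2 (n + 1) = aPow (-1) * (v2 n + v1 n) := by
  cases n with
  | zero => simp [v2, v1_zero]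
  | succ n =>
    simp only [v2, v1, Nat.add_sub_cancel, Finset.sum_Icc_succ_top (Nat.le_add_left 1 n), mul_add,
      Finset.mul_sum]
    congr 1
    · refine Finset.sum_congr rfl fun i _ => ?_
      rw [mul_left_comm, ← aPow_add]
      congr 2
      push_cast
      ring
    · rw [mul_comm]
      congr 2
      push_cast
      ring

theorem v2_one : v2 1 = 0 := by simp [v2]

/-- The product telescopes: for `2 ≤ j` the coefficient of `a ^ (j - n - 2)` in it is
`T_j - x T_{j-1} + T_{j-2} = 0`. -/
theorem mul_v2_succ (n : ℕ) :
    (aPow 1 + aPow (-1) - xVar) * v2 (n + 1) =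
      aPow (-(n + 1 : ℕ)) + v1 n - aPow (-1) * v1 (n + 1) := by
  induction n with
  | zero => simp [v2_one, v1_zero, v1_one]
  | succ n ih =>
    rw [v2_succ, aPow_neg_natCast_succ (n + 1), v1_add_two]
    linear_combination aPow (-1) * ih + v1 (n + 1) * aPow_mul_aPow_neg 1

theorem v2_add_two (n : ℕ) :
    v2 (n + 2) = xVar * v2 (n + 1) - v2 n + aPow (-(n + 1 : ℕ)) := by
  linear_combination v2_succ (n + 1) + mul_v2_succ n - aPow 1 * v2_succ n -
    (v2 n + v1 n) * aPow_mul_aPow_neg 1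

theorem sub_aPow_mul_eq_of_skein_recurrence {f : ℕ → KRing} {c : KRing}
    (h : ∀ n : ℕ, f (n + 2) + f n = xVar * (f (n + 1) + aPow (-(n + 1 : ℕ)) * c)) (n : ℕ) :
    f n - aPow (-n) * f 0 = (f 1 - aPow (-1) * f 0) * v1 n +
      (xVar * c - (aPow 1 + aPow (-1) - xVar) * f 0) * v2 n := by
  induction n using Nat.twoStepInduction with
  | zero => simp [v1_zero, v2_zero, aPow_zero]
  | one => simp [v1_one, v2_one]
  | more n ih ih' =>
    have hn : aPow (-n) = aPow 1 * aPow (-(n + 1 : ℕ)) := by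
      rw [aPow_neg_natCast_succ]
      linear_combination -aPow (-n) * aPow_mul_aPow_neg 1
    rw [v1_add_two, v2_add_two, aPow_neg_natCast_succ (n + 1)]
    linear_combination h n - ih + xVar * ih' - f 0 * hn

/-! ### Invariance up to powers of `a` -/

/-- Congruence modulo `I` up to multiplication by a power of `a`. -/
def CongrUpToPow (I : Ideal KRing) (P Q : KRing) : Prop :=
  ∃ i : ℤ, P - aPow i * Q ∈ I

namespace CongrUpToPow

variable {I : Ideal KRing} {P Q R : KRing}

theorem of_eq_aPow_mul (i : ℤ) (h : P = aPow i * Q) : CongrUpToPow I P Q :=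
  ⟨i, by rw [h, sub_self]; exact zero_mem _⟩

theorem of_eq (h : P = Q) : CongrUpToPow I P Q :=
  of_eq_aPow_mul 0 (by rw [aPow_zero, one_mul, h])

theorem symm (h : CongrUpToPow I P Q) : CongrUpToPow I Q P := by
  obtain ⟨i, hi⟩ := h
  refine ⟨-i, ?_⟩
  rw [show Q - aPow (-i) * P = -aPow (-i) * (P - aPow i * Q) by
    linear_combination -Q * aPow_mul_aPow_neg i]
  exact I.mul_mem_left _ hi

theorem trans (h : CongrUpToPow I P Q) (h' : CongrUpToPow I Q R) : CongrUpToPow I P R := by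
  obtain ⟨i, hi⟩ := h
  obtain ⟨j, hj⟩ := h'
  refine ⟨i + j, ?_⟩
  rw [show P - aPow (i + j) * R = (P - aPow i * Q) + aPow i * (Q - aPow j * R) by
    rw [aPow_add]; ring]
  exact add_mem hi (I.mul_mem_left _ hj)

theorem equivalence (I : Ideal KRing) : Equivalence (CongrUpToPow I) :=
  ⟨fun _ => of_eq rfl, symm, trans⟩

theorem aPow_mul (h : CongrUpToPow I P Q) (m n : ℤ) :
    CongrUpToPow I (aPow m * P) (aPow n * Q) :=
  ((of_eq_aPow_mul m rfl).trans h).trans (of_eq_aPow_mul n rfl).symm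

end CongrUpToPow

namespace IsKauffman

variable {Λ : LinkDiagram → KRing} (hΛ : IsKauffman Λ) (s : TwistSite)
include hΛ

theorem twistsCapCup_eq (n : ℕ) : Λ (s.twistsCapCup n) = aPow (-n) * Λ (s.twistsCapCup 0) := by
  induction n with
  | zero => simp [aPow_zero]
  | succ n ih =>
    have hkink : Local (fun r t => Kink r t (-1)) (s.twistsCapCup (n + 1)) (s.twistsCapCup n) :=
      ⟨s.below ++ List.replicate n (twistR s.pos), _, _, cup s.pos :: s.above, .capR s.pos,
        by simp [TwistSite.twistsCapCup, List.replicate_succ'],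
        by simp [TwistSite.twistsCapCup]⟩
    rw [hΛ.framing _ _ _ hkink, ih, ← mul_assoc, aPow_neg_natCast_succ]

theorem twistsTwistL_succ (n : ℕ) : Λ (s.twistsTwistL (n + 1)) = Λ (s.twists n) :=
  hΛ.regular _ _ ⟨s.below ++ List.replicate n (twistR s.pos), _, _, s.above,
    .reidemeisterTwoRL s.pos,
    by simp [TwistSite.twistsTwistL, List.replicate_succ'],
    by simp [TwistSite.twists]⟩

theorem twists_add_two (n : ℕ) :
    Λ (s.twists (n + 2)) + Λ (s.twists n) =
      xVar * (Λ (s.twists (n + 1)) + aPow (-(n + 1 : ℕ)) * Λ (s.twistsCapCup 0)) := by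
  rw [← hΛ.twistsCapCup_eq, ← hΛ.twistsTwistL_succ s n]
  exact hΛ.skein (s.below ++ List.replicate (n + 1) (twistR s.pos)) s.above s.pos _ _ _ _
    (by simp [TwistSite.twists, List.replicate_succ'])
    (by simp [TwistSite.twistsTwistL])
    rfl
    (by simp [TwistSite.twistsCapCup])

theorem twists_congr (k : ℕ) : CongrUpToPow (vIdeal k) (Λ (s.twists k)) (Λ (s.twists 0)) := by
  refine ⟨-k, ?_⟩
  rw [sub_aPow_mul_eq_of_skein_recurrence (f := fun n => Λ (s.twists n)) (hΛ.twists_add_two s) k]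
  exact Ideal.mem_span_pair.2 ⟨_, _, rfl⟩

theorem congr_of_moveEquivalent {k : ℕ} (hk : k ≠ 0) {D₁ D₂ : LinkDiagram}
    (h : MoveEquivalent k D₁ D₂) : CongrUpToPow (vIdeal k) (Λ D₁) (Λ D₂) := by
  refine ((CongrUpToPow.equivalence (vIdeal k)).comap Λ).eqvGen_iff.1 (h.mono ?_)
  rintro D D' (hreg | ⟨u, r, t, v, ⟨ε, hkink⟩, hD⟩ | htwist)
  · exact .of_eq (hΛ.regular D D' hreg)
  · exact .of_eq_aPow_mul ε (hΛ.framing ε D D' ⟨u, r, t, v, hkink, hD⟩)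
  · obtain ⟨s, rfl, rfl⟩ := exists_twistSite_of_local_twistMove hk htwist
    exact (hΛ.twists_congr s k).symm

end IsKauffman

theorem lam_congr {k : ℕ} (hk : k ≠ 0) {D₁ D₂ : LinkDiagram} (h : MoveEquivalent k D₁ D₂) :
    CongrUpToPow (vIdeal k) (Lam D₁) (Lam D₂) := by
  by_cases hΛ : ∃! Λ : LinkDiagram → KRing, IsKauffman Λ
  · rw [Lam, dif_pos hΛ]
    exact hΛ.choose_spec.1.congr_of_moveEquivalent hk h
  · rw [Lam, dif_neg hΛ]
    exact .of_eq rfl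

theorem F_congr {k : ℕ} (hk : k ≠ 0) {D₁ D₂ : LinkDiagram} (h : MoveEquivalent k D₁ D₂)
    (o₁ : D₁.Orientation) (o₂ : D₂.Orientation) : CongrUpToPow (vIdeal k) (F o₁) (F o₂) :=
  (lam_congr hk h).aPow_mul _ _

/-! ### Vanishing of `v₁` and `v₂` under substitutions -/

section RingHom

variable {R : Type*} [CommRing R] (φ : KRing →+* R)

theorem map_v1_add_two (n : ℕ) : φ (v1 (n + 2)) = φ xVar * φ (v1 (n + 1)) - φ (v1 n) := by
  rw [v1_add_two, map_sub, map_mul]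

theorem map_aPow_neg_natCast (n : ℕ) : φ (aPow (-n)) = φ (aPow (-1)) ^ n := by
  induction n with
  | zero => simp [aPow_zero]
  | succ n ih => rw [aPow_neg_natCast_succ, map_mul, ih, pow_succ']

theorem vIdeal_le_ker {k : ℕ} (h₁ : φ (v1 k) = 0) (h₂ : φ (v2 k) = 0) :
    vIdeal k ≤ RingHom.ker φ := by
  rw [vIdeal, Ideal.span_le]
  rintro _ (rfl | rfl)
  exacts [h₁, h₂]

variable {φ} {p q : R}

theorem mul_map_v1_succ_sub_map_v1 (hpq : p * q = 1) (hx : φ xVar = p + q) (n : ℕ) :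
    q * φ (v1 (n + 1)) - φ (v1 n) = q ^ (n + 1) := by
  induction n with
  | zero => simp [v1_zero, v1_one]
  | succ n ih =>
    rw [map_v1_add_two, hx]
    linear_combination q * ih + φ (v1 (n + 1)) * hpq

theorem sub_mul_map_v1 (hpq : p * q = 1) (hx : φ xVar = p + q) (n : ℕ) :
    (p - q) * φ (v1 n) = p ^ n - q ^ n := by
  cases n with
  | zero => simp [v1_zero]
  | succ n =>
    linear_combination
      mul_map_v1_succ_sub_map_v1 (mul_comm q p ▸ hpq) (hx.trans (add_comm p q)) n -
        mul_map_v1_succ_sub_map_v1 hpq hx n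

theorem vIdeal_le_ker_of_pow_eq [IsDomain R] {k : ℕ} (hk : k ≠ 0) (hpq : p * q = 1)
    (hx : φ xVar = p + q) (hp : p ^ (2 * k) = 1) (hp_ne : p ^ 2 ≠ 1)
    (hap : φ (aPow 1) ^ k = p ^ k) (ha_ne_p : φ (aPow 1) ≠ p) (ha_ne_q : φ (aPow 1) ≠ q) :
    vIdeal k ≤ RingHom.ker φ := by
  obtain ⟨n, rfl⟩ := Nat.exists_eq_add_one_of_ne_zero hk
  set α := φ (aPow 1)
  set β := φ (aPow (-1))
  have hαβ : α * β = 1 := by rw [← map_mul, aPow_mul_aPow_neg, map_one]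
  have hpq_pow : p ^ (n + 1) * q ^ (n + 1) = 1 := by rw [← mul_pow, hpq, one_pow]
  have hαβ_pow : α ^ (n + 1) * β ^ (n + 1) = 1 := by rw [← mul_pow, hαβ, one_pow]
  have hp_eq_q : p ^ (n + 1) = q ^ (n + 1) := by
    rw [two_mul, pow_add] at hp
    linear_combination q ^ (n + 1) * hp - p ^ (n + 1) * hpq_pow
  have hβ_eq_q : β ^ (n + 1) = q ^ (n + 1) := by
    linear_combination q ^ (n + 1) * hαβ_pow - β ^ (n + 1) * hpq_pow -
      q ^ (n + 1) * β ^ (n + 1) * hap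
  have hpq_ne : p - q ≠ 0 := fun h => hp_ne (by linear_combination p * h + hpq)
  have hv₁ : φ (v1 (n + 1)) = 0 := by
    refine (mul_eq_zero_iff_left hpq_ne).1 ?_
    rw [sub_mul_map_v1 hpq hx, hp_eq_q, sub_self]
  have hfactor_ne : α + β - (p + q) ≠ 0 := fun h =>
    mul_ne_zero (sub_ne_zero.2 ha_ne_p) (sub_ne_zero.2 ha_ne_q)
      (by linear_combination α * h - hαβ + hpq)
  refine vIdeal_le_ker φ hv₁ ((mul_eq_zero_iff_left hfactor_ne).1 ?_)
  have hclosed := congrArg φ (mul_v2_succ n)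
  simp only [map_mul, map_add, map_sub, hx, map_aPow_neg_natCast, hv₁] at hclosed
  have hsub := mul_map_v1_succ_sub_map_v1 hpq hx n
  rw [hv₁] at hsub
  linear_combination hclosed + hβ_eq_q - hsub

theorem pow_mul_map_v1 (hpq : p * q = 1) (hx : φ xVar = p + q) (n : ℕ) :
    p ^ n * φ (v1 n) = p * ∑ j ∈ Finset.range n, (p ^ 2) ^ j := by
  induction n with
  | zero => simp [v1_zero]
  | succ n ih =>
    have hpow : p ^ (n + 1) * q ^ (n + 1) = 1 := by rw [← mul_pow, hpq, one_pow]
    rw [geom_sum_succ]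
    linear_combination p ^ (n + 2) * mul_map_v1_succ_sub_map_v1 hpq hx n + p ^ 2 * ih +
      p * hpow - p ^ (n + 1) * φ (v1 (n + 1)) * hpq

theorem pow_mul_map_v2 (hx : φ xVar = φ (aPow 1) + φ (aPow (-1))) (n : ℕ) :
    φ (aPow 1) ^ n * φ (v2 n) =
      φ (aPow 1) * ∑ i ∈ Finset.range n, ∑ j ∈ Finset.range i, (φ (aPow 1) ^ 2) ^ j := by
  have hunit : φ (aPow 1) * φ (aPow (-1)) = 1 := by rw [← map_mul, aPow_mul_aPow_neg, map_one]
  induction n with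
  | zero => simp [v2_zero]
  | succ n ih =>
    rw [v2_succ, map_mul, map_add, Finset.sum_range_succ, mul_add (φ (aPow 1)), ← ih,
      ← pow_mul_map_v1 hunit hx]
    linear_combination φ (aPow 1) ^ n * (φ (v2 n) + φ (v1 n)) * hunit

end RingHom

section PrimeCharacteristic

variable {R : Type*} [CommRing R]

theorem sum_geom_sum_mul (y : R) (n : ℕ) :
    (∑ i ∈ Finset.range n, ∑ j ∈ Finset.range i, y ^ j) * (y - 1) =
      ∑ i ∈ Finset.range n, y ^ i - n := by
  rw [Finset.sum_mul]
  simp only [geom_sum_mul, Finset.sum_sub_distrib, Finset.sum_const, Finset.card_range, nsmul_one]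

variable {p : ℕ} (hp : p.Prime) (hpR : (p : R) = 0)
include hp hpR

/-- The sum is the value at `y` of the polynomial `(X ^ p - 1) / (X - 1) ^ 2` over `ZMod p`, whose
numerator is `(X - 1) ^ p`. -/
theorem sum_geom_sum_eq_sub_one_pow (y : R) :
    ∑ i ∈ Finset.range p, ∑ j ∈ Finset.range i, y ^ j = (y - 1) ^ (p - 2) := by
  nontriviality R
  have : Fact p.Prime := ⟨hp⟩
  have : CharP R p := (CharP.charP_iff_prime_eq_zero hp).2 hpR
  have hX : ∑ i ∈ Finset.range p, ∑ j ∈ Finset.range i, (Polynomial.X : Polynomial (ZMod p)) ^ j =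
      (Polynomial.X - 1) ^ (p - 2) := by
    have hne : (Polynomial.X - 1 : Polynomial (ZMod p)) ^ 2 ≠ 0 :=
      pow_ne_zero 2 (Polynomial.X_sub_C_ne_zero 1)
    refine mul_right_cancel₀ hne ?_
    rw [← pow_add, Nat.sub_add_cancel hp.two_le, sub_pow_char _ _ (p := p), one_pow, sq,
      ← mul_assoc, sum_geom_sum_mul, CharP.cast_eq_zero, sub_zero, geom_sum_mul]
  simpa [Polynomial.eval₂_pow] using
    congrArg (Polynomial.eval₂RingHom (ZMod.castHom dvd_rfl R) y) hX

theorem isUnit_add_one_of_sub_one_pow_eq_zero {y : R} (hy : (y - 1) ^ (p - 2) = 0) :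
    IsUnit (y + 1) := by
  obtain rfl | ⟨m, hm⟩ := hp.eq_two_or_odd'
  · have : Subsingleton R := subsingleton_of_zero_eq_one (by simpa using hy.symm)
    exact isUnit_of_subsingleton _
  · have htwo : IsUnit (2 : R) := .of_mul_eq_one (-m) (by
      rw [hm] at hpR
      push_cast at hpR
      linear_combination -hpR)
    rw [show y + 1 = 2 + (y - 1) by ring]
    exact IsNilpotent.isUnit_add_left_of_commute ⟨_, hy⟩ htwo (.all _ _)

theorem vIdeal_le_ker_of_prime {φ : KRing →+* R} (hx : φ xVar = φ (aPow 1) + φ (aPow (-1)))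
    (ha : (φ (aPow 1) ^ 2 - 1) ^ (p - 2) = 0) : vIdeal p ≤ RingHom.ker φ := by
  have hunit : φ (aPow 1) * φ (aPow (-1)) = 1 := by rw [← map_mul, aPow_mul_aPow_neg, map_one]
  have hcancel : IsUnit (φ (aPow 1) ^ p) := (IsUnit.of_mul_eq_one _ hunit).pow p
  have hsum := sum_geom_sum_eq_sub_one_pow hp hpR (φ (aPow 1) ^ 2)
  have hgeom : ∑ j ∈ Finset.range p, (φ (aPow 1) ^ 2) ^ j = 0 := by
    have h := sum_geom_sum_mul (φ (aPow 1) ^ 2) p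
    rwa [hsum, ha, hpR, zero_mul, sub_zero, eq_comm] at h
  refine vIdeal_le_ker φ (hcancel.mul_right_eq_zero.1 ?_) (hcancel.mul_right_eq_zero.1 ?_)
  · rw [pow_mul_map_v1 hunit hx, hgeom, mul_zero]
  · rw [pow_mul_map_v2 hx, hsum, ha, mul_zero]

end PrimeCharacteristic

/-! ### Evaluation at complex numbers -/

section evalC

variable {a₀ x₀ : ℂ} (ha : a₀ ≠ 0) (hx : x₀ ≠ 0)

theorem evalC_aPow (i : ℤ) : evalC a₀ x₀ ha hx (aPow i) = a₀ ^ i := by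
  simp [evalC, aPow]

theorem evalC_xVar : evalC a₀ x₀ ha hx xVar = x₀ := by
  simp [evalC, xVar]

end evalC

theorem vIdeal_le_ker_evalC {k : ℕ} (hk : k ≠ 0) {a₀ p₀ : ℂ} (ha : a₀ ^ (2 * k) = 1)
    (hp : p₀ ^ k = a₀ ^ k) (hap : a₀ ≠ p₀) (hap' : a₀ ≠ p₀⁻¹) (hp1 : p₀ ≠ 1) (hp1' : p₀ ≠ -1)
    (ha₀ : a₀ ≠ 0) (hx₀ : p₀ + p₀⁻¹ ≠ 0) :
    vIdeal k ≤ RingHom.ker (evalC a₀ (p₀ + p₀⁻¹) ha₀ hx₀) := by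
  have hp₀ : p₀ ≠ 0 := by
    rintro rfl
    simp at hx₀
  have ha₁ : evalC a₀ (p₀ + p₀⁻¹) ha₀ hx₀ (aPow 1) = a₀ := by rw [evalC_aPow, zpow_one]
  refine vIdeal_le_ker_of_pow_eq hk (mul_inv_cancel₀ hp₀) (evalC_xVar ha₀ hx₀) ?_ ?_ ?_ ?_ ?_
  · rw [mul_comm, pow_mul, hp, ← pow_mul, mul_comm, ha]
  · simp [hp1, hp1']
  · rw [ha₁, hp]
  · rwa [ha₁]
  · rwa [ha₁]

theorem setOf_zpow_mul_eq {G₀ : Type*} [GroupWithZero G₀] {a b c : G₀} (ha : a ≠ 0) {i : ℤ}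
    (h : b = a ^ i * c) : {z | ∃ j : ℤ, z = a ^ j * b} = {z | ∃ j : ℤ, z = a ^ j * c} := by
  ext z
  constructor
  · rintro ⟨j, rfl⟩
    exact ⟨j + i, by rw [h, zpow_add₀ ha, mul_assoc]⟩
  · rintro ⟨j, rfl⟩
    exact ⟨j - i, by rw [h, ← mul_assoc, ← zpow_add₀ ha, sub_add_cancel]⟩

theorem norm_eq_norm_of_pow_eq_one {a b c : ℂ} {n : ℕ} (hn : n ≠ 0) (ha : a ^ n = 1) {i : ℤ}
    (h : b = a ^ i * c) : ‖b‖ = ‖c‖ := by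
  rw [h, norm_mul, norm_zpow, Complex.norm_eq_one_of_pow_eq_one ha hn, one_zpow, one_mul]

/-! ### The substitution `x = a + a⁻¹` -/

theorem mem_of_algebraMap_mem_map {R S : Type*} [CommRing R] [CommRing S] [Algebra R S] (x : R)
    [IsLocalization.Away x S] {I : Ideal R} (hx : IsUnit (Ideal.Quotient.mk I x)) {P : R}
    (hP : algebraMap R S P ∈ I.map (algebraMap R S)) : P ∈ I := by
  have hmap : I.map (algebraMap R S) ≤ RingHom.ker (IsLocalization.Away.lift (S := S) x hx) :=
    Ideal.map_le_iff_le_comap.2 fun y hy => by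
      simpa [IsLocalization.Away.lift_eq] using Ideal.Quotient.eq_zero_iff_mem.2 hy
  simpa [IsLocalization.Away.lift_eq, Ideal.Quotient.eq_zero_iff_mem] using hmap hP

/-- The ideal `(p, (a ^ 2 - 1) ^ (p - 2))` of `ℤ[a^{±1}]`, which for `p = 5` is `fiveIdeal`.  It is
used for primes `p`, so the subtraction does not truncate; for `p = 2` it is the unit ideal. -/
noncomputable def substIdeal (p : ℕ) : Ideal ℤ[T;T⁻¹] :=
  Ideal.span {(p : ℤ[T;T⁻¹]), (LaurentPolynomial.T 2 - 1) ^ (p - 2)}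

theorem substX_aPow (i : ℤ) :
    substX (aPow i) = algebraMap ℤ[T;T⁻¹] ARing (LaurentPolynomial.T i) := by
  simp [substX, aPow]

theorem substX_xVar : substX xVar = substX (aPow 1) + substX (aPow (-1)) := by
  rw [substX_aPow, substX_aPow, ← map_add]
  simp [substX, xVar]

section Quotient

variable {R : Type*} [CommRing R] {p : ℕ} {ψ : ℤ[T;T⁻¹] →+* R}

theorem natCast_eq_zero_of_substIdeal_le_ker (h : substIdeal p ≤ RingHom.ker ψ) : (p : R) = 0 := by
  simpa using h (Ideal.subset_span (Set.mem_insert _ _))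

theorem sub_one_pow_eq_zero_of_substIdeal_le_ker (h : substIdeal p ≤ RingHom.ker ψ) :
    (ψ (LaurentPolynomial.T 1) ^ 2 - 1) ^ (p - 2) = 0 := by
  have hmem := h (Ideal.subset_span (Set.mem_insert_of_mem _ rfl))
  rwa [RingHom.mem_ker, map_pow, map_sub, map_one, ← Nat.cast_two, ← mul_one ((2 : ℕ) : ℤ),
    ← LaurentPolynomial.T_pow, map_pow] at hmem

end Quotient

theorem vIdeal_le_comap_substX {p : ℕ} (hp : p.Prime) :
    vIdeal p ≤ ((substIdeal p).map (algebraMap ℤ[T;T⁻¹] ARing)).comap substX := by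
  set J := (substIdeal p).map (algebraMap ℤ[T;T⁻¹] ARing)
  have hJ : substIdeal p ≤
      RingHom.ker ((Ideal.Quotient.mk J).comp (algebraMap ℤ[T;T⁻¹] ARing)) := fun P hP =>
    Ideal.Quotient.eq_zero_iff_mem.2 (Ideal.mem_map_of_mem _ hP)
  have hle : vIdeal p ≤ RingHom.ker ((Ideal.Quotient.mk J).comp substX) := by
    refine vIdeal_le_ker_of_prime hp (natCast_eq_zero_of_substIdeal_le_ker hJ) ?_ ?_
    · simp only [RingHom.comp_apply, substX_xVar, map_add]
    · simpa only [RingHom.comp_apply, substX_aPow] using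
        sub_one_pow_eq_zero_of_substIdeal_le_ker hJ
  exact fun P hP => (Ideal.Quotient.eq_zero_iff_mem (I := J)).1 (hle hP)

theorem isUnit_mk_T_one_add_T_neg_one {p : ℕ} (hp : p.Prime) :
    IsUnit (Ideal.Quotient.mk (substIdeal p)
      (LaurentPolynomial.T 1 + LaurentPolynomial.T (-1))) := by
  have hker : substIdeal p ≤ RingHom.ker (Ideal.Quotient.mk (substIdeal p)) := Ideal.mk_ker.ge
  have hunit := isUnit_add_one_of_sub_one_pow_eq_zero hp
    (natCast_eq_zero_of_substIdeal_le_ker hker) (sub_one_pow_eq_zero_of_substIdeal_le_ker hker)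
  refine isUnit_of_mul_isUnit_left (y := Ideal.Quotient.mk _ (LaurentPolynomial.T 1)) ?_
  convert hunit using 1
  simp only [← map_pow, ← map_mul, ← map_one (Ideal.Quotient.mk (substIdeal p)), ← map_add]
  congr 1
  rw [add_mul, ← sq, ← LaurentPolynomial.T_add, neg_add_cancel, LaurentPolynomial.T_zero]

theorem mem_substIdeal_of_algebraMap_mem {p : ℕ} (hp : p.Prime) {P : ℤ[T;T⁻¹]}
    (h : algebraMap ℤ[T;T⁻¹] ARing P ∈ (substIdeal p).map (algebraMap ℤ[T;T⁻¹] ARing)) :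
    P ∈ substIdeal p :=
  mem_of_algebraMap_mem_map _ (isUnit_mk_T_one_add_T_neg_one hp) h

end FiveMove

theorem corollary3p8_general {k : ℕ} (hk : k ≠ 0) {D₁ D₂ : LinkDiagram}
    (h : MoveEquivalent k D₁ D₂) :
    ((∃ i : ℤ, Lam D₁ - aPow i * Lam D₂ ∈ vIdeal k) ∧
      ∀ (o₁ : D₁.Orientation) (o₂ : D₂.Orientation),
        ∃ i : ℤ, F o₁ - aPow i * F o₂ ∈ vIdeal k) ∧
    (∀ a₀ p₀ : ℂ, a₀ ^ (2 * k) = 1 → p₀ ^ k = a₀ ^ k →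
      a₀ ≠ p₀ → a₀ ≠ p₀⁻¹ → p₀ ≠ 1 → p₀ ≠ -1 →
      ∀ (ha₀ : a₀ ≠ 0) (hx₀ : p₀ + p₀⁻¹ ≠ 0) (o₁ : D₁.Orientation) (o₂ : D₂.Orientation),
        let ev := evalC a₀ (p₀ + p₀⁻¹) ha₀ hx₀
        {z : ℂ | ∃ i : ℤ, z = a₀ ^ i * ev (F o₁)} = {z : ℂ | ∃ i : ℤ, z = a₀ ^ i * ev (F o₂)} ∧
          ‖ev (F o₁)‖ = ‖ev (F o₂)‖) ∧
    (k.Prime → ∀ (o₁ : D₁.Orientation) (o₂ : D₂.Orientation),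
      ∃ i : ℤ,
        substX (F o₁) - substX (aPow i) * substX (F o₂) ∈
            (substIdeal k).map (algebraMap ℤ[T;T⁻¹] ARing) ∧
          ∀ P₁ P₂ : ℤ[T;T⁻¹], algebraMap ℤ[T;T⁻¹] ARing P₁ = substX (F o₁) →
            algebraMap ℤ[T;T⁻¹] ARing P₂ = substX (F o₂) →
              P₁ - LaurentPolynomial.T i * P₂ ∈ substIdeal k) := by
  refine ⟨⟨lam_congr hk h, F_congr hk h⟩, ?_, ?_⟩
  · intro a₀ p₀ ha hp hap hap' hp1 hp1' ha₀ hx₀ o₁ o₂ ev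
    obtain ⟨i, hi⟩ := F_congr hk h o₁ o₂
    have hev : ev (F o₁) = a₀ ^ i * ev (F o₂) := by
      have hker := vIdeal_le_ker_evalC hk ha hp hap hap' hp1 hp1' ha₀ hx₀ hi
      rwa [RingHom.mem_ker, map_sub, map_mul, evalC_aPow, sub_eq_zero] at hker
    exact ⟨setOf_zpow_mul_eq ha₀ hev, norm_eq_norm_of_pow_eq_one (by positivity) ha hev⟩
  · intro hprime o₁ o₂
    obtain ⟨i, hi⟩ := F_congr hk h o₁ o₂
    have hsubst := vIdeal_le_comap_substX hprime hi
    rw [Ideal.mem_comap, map_sub, map_mul] at hsubst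
    refine ⟨i, hsubst, fun P₁ P₂ h₁ h₂ => mem_substIdeal_of_algebraMap_mem hprime ?_⟩
    rwa [map_sub, map_mul, h₁, h₂, ← substX_aPow]

theorem corollary3p8 (D₁ D₂ : LinkDiagram) (h : MoveEquivalent 5 D₁ D₂) :
    ((∃ i : ℤ, Lam D₁ - aPow i * Lam D₂ ∈ vIdeal 5) ∧
      ∀ (o₁ : D₁.Orientation) (o₂ : D₂.Orientation),
        ∃ i : ℤ, F o₁ - aPow i * F o₂ ∈ vIdeal 5) ∧
    (∀ (a₀ p₀ : ℂ) (ha : a₀ ^ 10 = 1) (hp : p₀ ^ 5 = a₀ ^ 5),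
      a₀ ≠ p₀ → a₀ ≠ p₀⁻¹ → p₀ ≠ 1 → p₀ ≠ -1 →
      ∀ (hI : p₀ ≠ Complex.I) (hI' : p₀ ≠ -Complex.I)
        (o₁ : D₁.Orientation) (o₂ : D₂.Orientation),
        let ev := evalC a₀ (p₀ + p₀⁻¹) (ne_zero_of_pow_ten ha) (add_inv_ne_zero ha hp hI hI')
        {z : ℂ | ∃ i : ℤ, z = a₀ ^ i * ev (F o₁)} = {z : ℂ | ∃ i : ℤ, z = a₀ ^ i * ev (F o₂)} ∧
          ‖ev (F o₁)‖ = ‖ev (F o₂)‖) ∧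
    (∀ (o₁ : D₁.Orientation) (o₂ : D₂.Orientation),
      ∃ i : ℤ,
        substX (F o₁) - substX (aPow i) * substX (F o₂) ∈
            fiveIdeal.map (algebraMap ℤ[T;T⁻¹] ARing) ∧
          ∀ P₁ P₂ : ℤ[T;T⁻¹], algebraMap ℤ[T;T⁻¹] ARing P₁ = substX (F o₁) →
            algebraMap ℤ[T;T⁻¹] ARing P₂ = substX (F o₂) →
              P₁ - LaurentPolynomial.T i * P₂ ∈ fiveIdeal) := by
  obtain ⟨hi, hii, hiii⟩ := corollary3p8_general (by norm_num) h
  exact ⟨hi, fun a₀ p₀ ha hp hap hap' hp1 hp1' _ _ => hii a₀ p₀ ha hp hap hap' hp1 hp1' _ _,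
    hiii Nat.prime_five⟩
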